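/- Let $0<q<1$. Put $(a;q)_n=\prod_{j=0}^{n-1}(1-aq^j)$ and $(a;q)_\infty=\prod_{j=0}^{\infty}(1-aq^j)$, let $\theta_q(x)=(x;q)_\infty\,(qx^{-1};q)_\infty$ for $x\in\mathbb{C}\setminus\{0\}$, and let $$A_q(z)={}_0\phi_1(-;0;q,-qz)=\sum_{n=0}^{\infty}\frac{q^{n^2}}{(q;q)_n}(-z)^n,\qquad z\in\mathbb{C},$$ be the Ramanujan entire function. Then for all $z\in\mathbb{C}\setminus\{0\}$ and $\ell\in\mathbb{Z}$ the two series below converge absolutely and $$\sum_{k=-\infty}^{\infty}z^{k}q^{k(k-1)/2}A_{q}\left(zq^{k+\ell}\right)A_{q}\left(zq^{k-\ell}\right)=(q;q)_{\infty}^{2}\,\theta_{q}(-z)\,\delta_{0,\ell},$$ $$\sum_{k=-\infty}^{\infty}(-1)^{k}q^{k(k-1)/2}A_{q}\left(zq^{k+\ell}\right)A_{q}\left(z^{-1}q^{k-\ell}\right)=0,$$ where $\delta_{0,\ell}=1$ if $\ell=0$ and $\delta_{0,\ell}=0$ otherwise. -/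

import Mathlib

namespace QSeries

noncomputable section

/-- The finite `q`-shifted factorial `(a; q)_n = ∏_{j=0}^{n-1} (1 - a q^j)`. -/
def qPoch (a q : ℂ) (n : ℕ) : ℂ := ∏ j ∈ Finset.range n, (1 - a * q ^ j)

/-- The infinite `q`-shifted factorial `(a; q)_∞ = ∏_{j=0}^∞ (1 - a q^j)`
(for `|q| < 1` the product converges absolutely). -/
def qPochInf (a q : ℂ) : ℂ := ∏' j : ℕ, (1 - a * q ^ j)

/-- The basic hypergeometric series
`₀φ₁(-; b; q, z) = ∑_{n ≥ 0} ((-1)^n q^{n(n-1)/2})^{1+s-r} z^n / ((q; q)_n (b; q)_n)`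
with `r = 0` and `s = 1`, so that the exponent `1 + s - r` is `2`. -/
def phi01 (b q z : ℂ) : ℂ :=
  ∑' n : ℕ, ((-1) ^ n * q ^ (n * (n - 1) / 2)) ^ 2 * z ^ n / (qPoch q q n * qPoch b q n)

/-- The Ramanujan entire function `A_q(z) = ₀φ₁(-; 0; q, -qz)`. -/
def ramanujanA (q z : ℂ) : ℂ := phi01 0 q (-(q * z))

/-- The theta function `θ_q(x) = (x; q)_∞ (q x⁻¹; q)_∞`, for `x ≠ 0`. -/
def theta (q x : ℂ) : ℂ := qPochInf x q * qPochInf (q * x⁻¹) q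

end

end QSeries

/-!
Expand `A_q(w t q^k) A_q(w t⁻¹ q^k)` as a double series over `(n, m)`, multiply by
`w^k q^{k(k-1)/2}` and replace `k` by `k - n - m`: the quadratic form in the exponent of `q` splits,
and the sum over `k` factors as a kernel depending only on `t` times `∑ w^k q^{k(k-1)/2}`. The
second factor is a theta function by the Jacobi triple product. For `t = q^l` with `l ≥ 0`, Euler's
expansion of `(x; q)_∞` sums the kernel over `m`, leaving multiples of `(q^{1-n-l}; q)_∞`, all of
which vanish except when `n = l = 0`; the kernel sum is invariant under `t ↦ t⁻¹`. The second
identity is the case `w = -1`, where the theta function itself vanishes.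
-/

namespace QSeries

open Filter Topology

/-- The exponent `k (k - 1) / 2` of the theta series, for an integer `k`; the division is exact. -/
def tri (k : ℤ) : ℤ := k * (k - 1) / 2

theorem two_mul_tri (k : ℤ) : 2 * tri k = k * (k - 1) :=
  Int.mul_ediv_cancel' (Int.even_mul_pred_self k).two_dvd

theorem tri_add (a b : ℤ) : tri (a + b) = tri a + tri b + a * b := by
  linarith [two_mul_tri (a + b), two_mul_tri a, two_mul_tri b,
    show (a + b) * (a + b - 1) = a * (a - 1) + b * (b - 1) + 2 * (a * b) by ring]

theorem tri_neg (a : ℤ) : tri (-a) = tri a + a := by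
  linarith [two_mul_tri (-a), two_mul_tri a,
    show (-a) * (-a - 1) = a * (a - 1) + 2 * a by ring]

theorem tri_sub (a b : ℤ) : tri (a - b) = tri a + tri b + b - a * b := by
  rw [sub_eq_add_neg, tri_add, tri_neg]
  ring

theorem choose_two_succ (n : ℕ) : (n + 1).choose 2 = n.choose 2 + n := by
  rw [Nat.choose_succ_succ' n 1, Nat.choose_one_right, add_comm]

theorem tri_natCast (n : ℕ) : tri n = (n.choose 2 : ℕ) := by
  have h := two_mul_tri n
  have h' : ((n.choose 2 * 2 : ℕ) : ℤ) = ((n * (n - 1) : ℕ) : ℤ) := by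
    rw [Nat.choose_two_right, Nat.div_mul_cancel (Nat.even_mul_pred_self n).two_dvd]
  rcases n with _ | n
  · rfl
  · push_cast [Nat.add_sub_cancel] at h h' ⊢
    linarith

section Series

theorem hasSum_shear {ι G R : Type*} [AddGroup G] [NormedRing R] [CompleteSpace R] (σ : ι → G)
    {f : ι → R} {g F : G → R} (hf : Summable fun i => ‖f i‖) (hg : Summable fun k => ‖g k‖)
    (hF : ∀ k, HasSum (fun i => f i * g (k + σ i)) (F k)) :
    HasSum F ((∑' i, f i) * ∑' k, g k) := by
  have hfg : HasSum (fun p : ι × G => f p.1 * g p.2) ((∑' i, f i) * ∑' k, g k) :=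
    hf.of_norm.hasSum.mul hg.of_norm.hasSum (summable_mul_of_summable_norm hf hg)
  let shear : G × ι ≃ ι × G := (Equiv.prodComm G ι).trans
    (Equiv.prodShear (Equiv.refl ι) fun i => Equiv.addRight (σ i))
  exact (shear.hasSum_iff.mpr hfg).prod_fiberwise hF

variable {𝕜 : Type*} [NormedField 𝕜]

theorem norm_mul_pow_mul_le {q : 𝕜} (hq : ‖q‖ ≤ 1) (c x : 𝕜) (n : ℕ) :
    ‖c * (x * q) ^ n‖ ≤ ‖c * x ^ n‖ := by
  simp only [norm_mul, norm_pow]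
  gcongr
  exact mul_le_of_le_one_right (norm_nonneg _) hq

theorem tendsto_tsum_mul_pow [CompleteSpace 𝕜] {q : 𝕜} (hq : ‖q‖ < 1) {c : ℕ → 𝕜} {x : 𝕜}
    (hs : Summable fun n => ‖c n * x ^ n‖) :
    Tendsto (fun k : ℕ => ∑' n, c n * (x * q ^ k) ^ n) atTop (𝓝 (c 0)) := by
  have h_zero : ∑' n, c n * (0 : 𝕜) ^ n = c 0 := by
    rw [tsum_eq_single 0 fun n hn => by simp [hn]]
    simp
  rw [← h_zero]
  refine tendsto_tsum_of_dominated_convergence hs (fun n => ?_) (Eventually.of_forall fun k n => ?_)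
  · refine (Tendsto.pow ?_ n).const_mul _
    simpa using (tendsto_pow_atTop_nhds_zero_of_norm_lt_one hq).const_mul x
  · exact norm_mul_pow_mul_le (by simpa using pow_le_one₀ (norm_nonneg q) hq.le) _ _ _

theorem tsum_mul_pow_sub [CompleteSpace 𝕜] {q : 𝕜} (hq : ‖q‖ ≤ 1) {c : ℕ → 𝕜} {x : 𝕜}
    (hs : Summable fun n => ‖c n * x ^ n‖) :
    ∑' n, c n * x ^ n - ∑' n, c n * (x * q) ^ n =
      x * ∑' n, c (n + 1) * (1 - q * q ^ n) * x ^ n := by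
  have hs' : Summable fun n => c n * (x * q) ^ n :=
    hs.of_norm_bounded fun n => norm_mul_pow_mul_le hq _ _ _
  rw [← hs.of_norm.tsum_sub hs', (hs.of_norm.sub hs').tsum_eq_zero_add, ← tsum_mul_left]
  simp only [pow_zero, sub_self, zero_add]
  refine tsum_congr fun n => ?_
  ring

theorem summable_norm_pow_mul_choose_two {q : 𝕜} (hq : ‖q‖ < 1) (c : 𝕜) :
    Summable fun n : ℕ => ‖c ^ n * q ^ n.choose 2‖ := by
  have h_ratio : Tendsto (fun n : ℕ => ‖c‖ * ‖q‖ ^ n) atTop (𝓝 0) := by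
    simpa using (tendsto_pow_atTop_nhds_zero_of_lt_one (norm_nonneg q) hq).const_mul ‖c‖
  refine summable_of_ratio_norm_eventually_le (r := 1 / 2) (by norm_num) ?_
  filter_upwards [h_ratio.eventually_le_const (u := 1 / 2) (by norm_num)] with n hn
  calc ‖‖c ^ (n + 1) * q ^ (n + 1).choose 2‖‖
      = ‖c‖ * ‖q‖ ^ n * ‖‖c ^ n * q ^ n.choose 2‖‖ := by
        simp only [norm_norm, norm_mul, norm_pow, choose_two_succ]
        ring
    _ ≤ 1 / 2 * ‖‖c ^ n * q ^ n.choose 2‖‖ := by gcongr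

theorem summable_norm_zpow_mul_tri {q : 𝕜} (hq : ‖q‖ < 1) (hq0 : q ≠ 0) (w : 𝕜) :
    Summable fun k : ℤ => ‖w ^ k * q ^ tri k‖ := by
  refine Summable.of_nat_of_neg ?_ ?_
  · simpa only [tri_natCast, zpow_natCast] using summable_norm_pow_mul_choose_two hq w
  · refine (summable_norm_pow_mul_choose_two hq (w⁻¹ * q)).congr fun n => ?_
    rw [tri_neg, tri_natCast, zpow_add₀ hq0, zpow_neg, mul_pow, inv_pow]
    simp only [zpow_natCast]
    ring_nf

end Series

section Pochhammer

variable {q : ℂ}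

theorem qPoch_succ (a q : ℂ) (n : ℕ) : qPoch a q (n + 1) = qPoch a q n * (1 - a * q ^ n) :=
  Finset.prod_range_succ _ _

theorem qPoch_zero (a q : ℂ) : qPoch a q 0 = 1 := rfl

theorem summable_norm_neg_mul_pow (hq : ‖q‖ < 1) (a : ℂ) :
    Summable fun j : ℕ => ‖-(a * q ^ j)‖ := by
  simp only [norm_neg, norm_mul, norm_pow]
  exact (summable_geometric_of_lt_one (norm_nonneg q) hq).mul_left _

theorem multipliable_one_sub_mul_pow (hq : ‖q‖ < 1) (a : ℂ) :
    Multipliable fun j : ℕ => 1 - a * q ^ j := by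
  simpa only [sub_eq_add_neg] using
    multipliable_one_add_of_summable (summable_norm_neg_mul_pow hq a)

theorem tendsto_qPoch (hq : ‖q‖ < 1) (a : ℂ) :
    Tendsto (qPoch a q) atTop (𝓝 (qPochInf a q)) :=
  (multipliable_one_sub_mul_pow hq a).tendsto_prod_tprod_nat

theorem qPoch_mul_qPochInf (hq : ‖q‖ < 1) (a : ℂ) (n : ℕ) :
    qPoch a q n * qPochInf (a * q ^ n) q = qPochInf a q := by
  have h_shift : ∀ j : ℕ, 1 - a * q ^ n * q ^ j = 1 - a * q ^ (j + n) := fun j => by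
    rw [mul_assoc, ← pow_add, add_comm]
  have h_mult := multipliable_one_sub_mul_pow hq (a * q ^ n)
  simp only [h_shift] at h_mult
  simp only [qPoch, qPochInf, h_shift]
  exact Multipliable.prod_mul_tprod_nat_mul' h_mult

theorem one_sub_mul_pow_ne_zero (hq : ‖q‖ < 1) (n : ℕ) : 1 - q * q ^ n ≠ 0 := by
  intro h
  have h_norm : ‖q ^ (n + 1)‖ < 1 := by
    rw [norm_pow]
    exact pow_lt_one₀ (norm_nonneg _) hq n.succ_ne_zero
  rw [pow_succ', ← sub_eq_zero.mp h, norm_one] at h_norm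
  exact lt_irrefl _ h_norm

theorem qPoch_self_ne_zero (hq : ‖q‖ < 1) (n : ℕ) : qPoch q q n ≠ 0 :=
  Finset.prod_ne_zero_iff.mpr fun j _ => one_sub_mul_pow_ne_zero hq j

theorem qPochInf_self_ne_zero (hq : ‖q‖ < 1) : qPochInf q q ≠ 0 := by
  simpa only [qPochInf, sub_eq_add_neg] using
    tprod_one_add_ne_zero_of_summable (f := fun j : ℕ => -(q * q ^ j))
      (fun j => by simpa only [sub_eq_add_neg] using one_sub_mul_pow_ne_zero hq j)
      (summable_norm_neg_mul_pow hq q)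

theorem exists_norm_inv_qPoch_self_le (hq : ‖q‖ < 1) :
    ∃ C : ℝ, ∀ n, ‖(qPoch q q n)⁻¹‖ ≤ C := by
  obtain ⟨C, hC⟩ := ((tendsto_qPoch hq q).inv₀ (qPochInf_self_ne_zero hq)).norm.bddAbove_range
  exact ⟨C, fun n => hC ⟨n, rfl⟩⟩

theorem inv_qPoch_self_succ_mul (hq : ‖q‖ < 1) (n : ℕ) :
    (qPoch q q (n + 1))⁻¹ * (1 - q * q ^ n) = (qPoch q q n)⁻¹ := by
  rw [qPoch_succ, mul_inv, inv_mul_cancel_right₀ (one_sub_mul_pow_ne_zero hq n)]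

theorem qPochInf_zpow_of_nonpos (hq0 : q ≠ 0) {j : ℤ} (hj : j ≤ 0) : qPochInf (q ^ j) q = 0 := by
  have h_factor : 1 - q ^ j * q ^ (-j).toNat = 0 := by
    rw [← zpow_natCast, Int.toNat_of_nonneg (by lia), ← zpow_add₀ hq0]
    simp
  exact tprod_of_exists_eq_zero ⟨_, h_factor⟩

theorem qPochInf_zpow_natCast_add_one (hq : ‖q‖ < 1) (n : ℕ) :
    qPochInf (q ^ ((n : ℤ) + 1)) q = qPochInf q q * (qPoch q q n)⁻¹ := by
  rw [← qPoch_mul_qPochInf hq q n, mul_right_comm, mul_inv_cancel₀ (qPoch_self_ne_zero hq n),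
    one_mul, ← pow_succ']
  norm_cast

end Pochhammer

section Euler

variable {q : ℂ}

theorem summable_norm_euler (hq : ‖q‖ < 1) (x : ℂ) :
    Summable fun n : ℕ => ‖(-1) ^ n * q ^ n.choose 2 * (qPoch q q n)⁻¹ * x ^ n‖ := by
  obtain ⟨C, hC⟩ := exists_norm_inv_qPoch_self_le hq
  refine Summable.of_nonneg_of_le (fun _ => norm_nonneg _) (fun n => ?_)
    ((summable_norm_pow_mul_choose_two hq x).mul_right C)
  calc ‖(-1) ^ n * q ^ n.choose 2 * (qPoch q q n)⁻¹ * x ^ n‖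
      = ‖x ^ n * q ^ n.choose 2‖ * ‖(qPoch q q n)⁻¹‖ := by
        simp only [norm_mul, norm_pow, norm_neg, norm_one, one_pow]
        ring
    _ ≤ ‖x ^ n * q ^ n.choose 2‖ * C := by gcongr; exact hC n

theorem tsum_euler_eq_one_sub_mul (hq : ‖q‖ < 1) (x : ℂ) :
    ∑' n : ℕ, (-1) ^ n * q ^ n.choose 2 * (qPoch q q n)⁻¹ * x ^ n =
      (1 - x) * ∑' n : ℕ, (-1) ^ n * q ^ n.choose 2 * (qPoch q q n)⁻¹ * (x * q) ^ n := by
  have h_diff := tsum_mul_pow_sub hq.le (summable_norm_euler hq x)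
  have h_coeff : ∀ n : ℕ, (-1) ^ (n + 1) * q ^ (n + 1).choose 2 * (qPoch q q (n + 1))⁻¹ *
      (1 - q * q ^ n) * x ^ n =
      -((-1) ^ n * q ^ n.choose 2 * (qPoch q q n)⁻¹ * (x * q) ^ n) := fun n => by
    rw [mul_assoc _ _ (1 - q * q ^ n), inv_qPoch_self_succ_mul hq, choose_two_succ]
    ring
  simp only [h_coeff, tsum_neg] at h_diff
  linear_combination h_diff

/-- Euler: the series satisfies `f(x) = (1 - x) f(x q)`, and `f(x q^k) → 1`. -/
theorem hasSum_qPochInf (hq : ‖q‖ < 1) (x : ℂ) :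
    HasSum (fun n : ℕ => (-1) ^ n * q ^ n.choose 2 * (qPoch q q n)⁻¹ * x ^ n) (qPochInf x q) := by
  refine (summable_norm_euler hq x).of_norm.hasSum_iff.mpr ?_
  have h_iterate : ∀ k : ℕ,
      qPoch x q k * ∑' n : ℕ, (-1) ^ n * q ^ n.choose 2 * (qPoch q q n)⁻¹ * (x * q ^ k) ^ n =
        ∑' n : ℕ, (-1) ^ n * q ^ n.choose 2 * (qPoch q q n)⁻¹ * x ^ n := by
    intro k
    induction k with
    | zero => simp only [qPoch_zero, pow_zero, mul_one, one_mul]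
    | succ k ih =>
      rw [← ih, tsum_euler_eq_one_sub_mul hq (x * q ^ k), qPoch_succ, pow_succ]
      simp only [mul_assoc]
  have h_lim := (tendsto_qPoch hq x).mul (tendsto_tsum_mul_pow hq (summable_norm_euler hq x))
  simp only [h_iterate] at h_lim
  simpa [qPoch_zero] using tendsto_nhds_unique tendsto_const_nhds h_lim

theorem summable_norm_inv_qPoch_mul_pow (hq : ‖q‖ < 1) {x : ℂ} (hx : ‖x‖ < 1) :
    Summable fun n : ℕ => ‖(qPoch q q n)⁻¹ * x ^ n‖ := by
  obtain ⟨C, hC⟩ := exists_norm_inv_qPoch_self_le hq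
  refine Summable.of_nonneg_of_le (fun _ => norm_nonneg _) (fun n => ?_)
    ((summable_geometric_of_lt_one (norm_nonneg x) hx).mul_left C)
  rw [norm_mul, norm_pow]
  gcongr
  exact hC n

theorem one_sub_mul_tsum_inv_qPoch (hq : ‖q‖ < 1) {x : ℂ} (hx : ‖x‖ < 1) :
    (1 - x) * ∑' n : ℕ, (qPoch q q n)⁻¹ * x ^ n = ∑' n : ℕ, (qPoch q q n)⁻¹ * (x * q) ^ n := by
  have h_diff := tsum_mul_pow_sub hq.le (summable_norm_inv_qPoch_mul_pow hq hx)
  simp only [inv_qPoch_self_succ_mul hq] at h_diff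
  linear_combination h_diff

/-- Euler: the series satisfies `(1 - x) f(x) = f(x q)`, and `f(x q^k) → 1`. -/
theorem qPochInf_mul_tsum_inv_qPoch (hq : ‖q‖ < 1) {x : ℂ} (hx : ‖x‖ < 1) :
    qPochInf x q * ∑' n : ℕ, (qPoch q q n)⁻¹ * x ^ n = 1 := by
  have h_iterate : ∀ k : ℕ, qPoch x q k * ∑' n : ℕ, (qPoch q q n)⁻¹ * x ^ n =
      ∑' n : ℕ, (qPoch q q n)⁻¹ * (x * q ^ k) ^ n := by
    intro k
    induction k with
    | zero => simp only [qPoch_zero, pow_zero, mul_one, one_mul]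
    | succ k ih =>
      have hxk : ‖x * q ^ k‖ < 1 := by
        rw [norm_mul, norm_pow]
        exact (mul_le_of_le_one_right (norm_nonneg _)
          (pow_le_one₀ (norm_nonneg _) hq.le)).trans_lt hx
      rw [qPoch_succ, mul_right_comm, ih, mul_comm, one_sub_mul_tsum_inv_qPoch hq hxk, pow_succ]
      simp only [mul_assoc]
  have h_lim := tendsto_tsum_mul_pow hq (summable_norm_inv_qPoch_mul_pow hq hx)
  simp only [← h_iterate] at h_lim
  simpa [qPoch_zero] using tendsto_nhds_unique ((tendsto_qPoch hq x).mul_const _) h_lim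

end Euler

section Theta

variable {q : ℂ}

theorem hasSum_zpow_mul_tri_mul_qPochInf (hq : ‖q‖ < 1) (hq0 : q ≠ 0) (z : ℂ) :
    HasSum (fun k : ℤ => z ^ k * q ^ tri k * qPochInf (q ^ (k + 1)) q)
      (qPochInf q q * qPochInf (-z) q) := by
  refine (Function.Injective.hasSum_iff Nat.cast_injective fun k hk => ?_).mp
    (((hasSum_qPochInf hq (-z)).mul_left (qPochInf q q)).congr_fun fun n => ?_)
  · have hk_neg : k < 0 := by
      by_contra hk_nonneg
      exact hk ⟨k.toNat, Int.toNat_of_nonneg (by lia)⟩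
    rw [qPochInf_zpow_of_nonpos hq0 (by lia), mul_zero]
  · have h_sign : (-1 : ℂ) ^ n * (-z) ^ n = z ^ n := by rw [← mul_pow, neg_one_mul, neg_neg]
    rw [Function.comp_apply, qPochInf_zpow_natCast_add_one hq, tri_natCast, zpow_natCast,
      zpow_natCast, ← h_sign]
    ring

theorem tsum_zpow_mul_tri_of_norm_lt (hq : ‖q‖ < 1) (hq0 : q ≠ 0) {z : ℂ} (hz : ‖q‖ < ‖z‖) :
    ∑' k : ℤ, z ^ k * q ^ tri k = qPochInf q q * theta q (-z) := by
  have hz0 : z ≠ 0 := norm_pos_iff.mp ((norm_nonneg q).trans_lt hz)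
  have hx : ‖q * (-z)⁻¹‖ < 1 := by
    rw [norm_mul, norm_inv, norm_neg, ← div_eq_mul_inv]
    exact (div_lt_one (norm_pos_iff.mpr hz0)).mpr hz
  -- The theta series times Euler's series for `1 / (-q/z; q)_∞`, resummed by `hasSum_qPochInf`.
  have h_prod : HasSum (fun k : ℤ => z ^ k * q ^ tri k * qPochInf (q ^ (k + 1)) q)
      ((∑' m : ℕ, (qPoch q q m)⁻¹ * (q * (-z)⁻¹) ^ m) * ∑' k : ℤ, z ^ k * q ^ tri k) := by
    refine hasSum_shear (fun m : ℕ => (m : ℤ)) (summable_norm_inv_qPoch_mul_pow hq hx)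
      (summable_norm_zpow_mul_tri hq hq0 z) fun k => ?_
    refine ((hasSum_qPochInf hq (q ^ (k + 1))).mul_left (z ^ k * q ^ tri k)).congr_fun fun m => ?_
    rw [tri_add, tri_natCast, zpow_add₀ hz0, zpow_add₀ hq0, zpow_add₀ hq0, zpow_add₀ hq0, zpow_one,
      zpow_natCast, zpow_natCast, zpow_mul, zpow_natCast, inv_neg, mul_pow, mul_pow, neg_pow,
      inv_pow]
    field_simp
  have h_unique := h_prod.unique (hasSum_zpow_mul_tri_mul_qPochInf hq hq0 z)
  have h_inv := qPochInf_mul_tsum_inv_qPoch hq hx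
  rw [theta]
  linear_combination qPochInf (q * (-z)⁻¹) q * h_unique - (∑' k : ℤ, z ^ k * q ^ tri k) * h_inv

theorem tsum_mul_inv_zpow_mul_tri (hq0 : q ≠ 0) (z : ℂ) :
    ∑' k : ℤ, (q * z⁻¹) ^ k * q ^ tri k = ∑' k : ℤ, z ^ k * q ^ tri k := by
  rw [← (Equiv.neg ℤ).tsum_eq fun k : ℤ => z ^ k * q ^ tri k]
  refine tsum_congr fun k => ?_
  rw [Equiv.neg_apply, tri_neg, zpow_add₀ hq0, mul_zpow, inv_zpow']
  ring

theorem theta_mul_inv (hq0 : q ≠ 0) (x : ℂ) : theta q (q * x⁻¹) = theta q x := by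
  rw [theta, theta, mul_inv, inv_inv, mul_inv_cancel_left₀ hq0, mul_comm]

theorem jacobi_triple_product (hq : ‖q‖ < 1) (hq0 : q ≠ 0) {z : ℂ} (hz : z ≠ 0) :
    ∑' k : ℤ, z ^ k * q ^ tri k = qPochInf q q * theta q (-z) := by
  rcases lt_or_ge ‖q‖ ‖z‖ with h_lt | h_le
  · exact tsum_zpow_mul_tri_of_norm_lt hq hq0 h_lt
  · -- Both sides are invariant under `z ↦ q / z`.
    have h_lt : ‖q‖ < ‖q * z⁻¹‖ := by
      rw [norm_mul, norm_inv]
      exact lt_mul_of_one_lt_right (norm_pos_iff.mpr hq0)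
        (one_lt_inv_iff₀.mpr ⟨norm_pos_iff.mpr hz, h_le.trans_lt hq⟩)
    rw [← tsum_mul_inv_zpow_mul_tri hq0, tsum_zpow_mul_tri_of_norm_lt hq hq0 h_lt,
      ← mul_neg, ← inv_neg, theta_mul_inv hq0]

theorem theta_one (q : ℂ) : theta q 1 = 0 := by
  have h_factor : qPochInf 1 q = 0 := tprod_of_exists_eq_zero ⟨0, by simp⟩
  rw [theta, h_factor, zero_mul]

end Theta

section Ramanujan

variable {q : ℂ}

theorem summable_norm_ramanujanA (hq : ‖q‖ < 1) (x : ℂ) :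
    Summable fun n : ℕ => ‖(-1) ^ n * q ^ n ^ 2 * (qPoch q q n)⁻¹ * x ^ n‖ := by
  refine Summable.of_nonneg_of_le (fun _ => norm_nonneg _) (fun n => ?_)
    (summable_norm_euler hq x)
  have h_exp : n.choose 2 ≤ n ^ 2 := by
    rw [Nat.choose_two_right, sq]
    exact (Nat.div_le_self _ _).trans (Nat.mul_le_mul_left n (Nat.sub_le n 1))
  simp only [norm_mul, norm_pow]
  gcongr ?_ * ?_ * ?_ * ?_
  exact pow_le_pow_of_le_one (norm_nonneg _) hq.le h_exp

theorem hasSum_ramanujanA (hq : ‖q‖ < 1) (x : ℂ) :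
    HasSum (fun n : ℕ => (-1) ^ n * q ^ n ^ 2 * (qPoch q q n)⁻¹ * x ^ n) (ramanujanA q x) := by
  refine (summable_norm_ramanujanA hq x).of_norm.hasSum_iff.mpr (tsum_congr fun n => ?_)
  have h_zero : qPoch 0 q n = 1 := by simp [qPoch]
  have h_sign : ((-1 : ℂ) ^ n) ^ 2 = 1 := by rw [← pow_mul, mul_comm, pow_mul]; simp
  have h_exp : n ^ 2 = n * (n - 1) / 2 * 2 + n := by
    rw [Nat.div_mul_cancel (Nat.even_mul_pred_self n).two_dvd]
    rcases n with _ | n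
    · rfl
    · rw [Nat.add_sub_cancel]
      ring
  rw [h_zero, h_exp, pow_add, pow_mul, mul_pow ((-1) ^ n), h_sign, neg_pow (q * x), mul_pow q]
  ring

/-- The `(n, m)` coefficient that remains, after the shift `k ↦ k - n - m`, when
`w^k q^{k(k-1)/2} A_q(w t q^k) A_q(w t⁻¹ q^k)` is expanded: its sum over `(n, m)` is the factor of
`∑ w^k q^{k(k-1)/2}`. -/
noncomputable def productKernel (q t : ℂ) (p : ℕ × ℕ) : ℂ :=
  (-1) ^ p.1 * (-1) ^ p.2 * (qPoch q q p.1)⁻¹ * (qPoch q q p.2)⁻¹ *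
    (t ^ ((p.1 : ℤ) - p.2) * q ^ tri (p.1 - p.2) * q ^ p.1)

theorem summable_norm_productKernel (hq : ‖q‖ < 1) (hq0 : q ≠ 0) (t : ℂ) :
    Summable fun p => ‖productKernel q t p‖ := by
  obtain ⟨C, hC⟩ := exists_norm_inv_qPoch_self_le hq
  have hC0 : 0 ≤ C := (norm_nonneg _).trans (hC 0)
  have h_bound := summable_mul_of_summable_norm (summable_norm_zpow_mul_tri hq hq0 t)
    (g := fun n : ℕ => q ^ n) (by
      simpa only [norm_pow] using summable_geometric_of_lt_one (norm_nonneg q) hq)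
  have h_inj : Function.Injective fun p : ℕ × ℕ => ((p.1 : ℤ) - p.2, p.1) := by
    rintro ⟨a, b⟩ ⟨c, d⟩ h
    simp only [Prod.mk.injEq] at h ⊢
    lia
  refine Summable.of_nonneg_of_le (fun _ => norm_nonneg _) (fun p => ?_)
    ((h_bound.norm.comp_injective h_inj).mul_left (C * C))
  rw [productKernel, norm_mul, norm_mul]
  refine mul_le_mul_of_nonneg_right (mul_le_mul ?_ (hC _) (norm_nonneg _) hC0) (norm_nonneg _)
  simpa using hC p.1

theorem productKernel_mul_zpow_mul_tri (hq0 : q ≠ 0) {w t : ℂ} (hw : w ≠ 0) (ht : t ≠ 0)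
    (n m : ℕ) (k : ℤ) :
    productKernel q t (n, m) * (w ^ (k + (n + m)) * q ^ tri (k + (n + m))) =
      w ^ k * q ^ tri k * (((-1) ^ n * q ^ n ^ 2 * (qPoch q q n)⁻¹ * (w * t * q ^ k) ^ n) *
        ((-1) ^ m * q ^ m ^ 2 * (qPoch q q m)⁻¹ * (w * t⁻¹ * q ^ k) ^ m)) := by
  have h_exp : q ^ tri ((n : ℤ) - m) * q ^ n * q ^ tri (k + (n + m)) =
      q ^ tri k * q ^ n ^ 2 * q ^ m ^ 2 * (q ^ k) ^ n * (q ^ k) ^ m := by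
    simp only [← zpow_natCast, ← zpow_mul, ← zpow_add₀ hq0, tri_add, tri_sub]
    congr 1
    push_cast
    linear_combination two_mul_tri n + two_mul_tri m
  simp only [productKernel, zpow_sub₀ ht, zpow_add₀ hw, zpow_natCast, mul_pow, inv_pow,
    div_eq_mul_inv]
  linear_combination ((-1) ^ n * (-1) ^ m * (qPoch q q n)⁻¹ * (qPoch q q m)⁻¹ *
    (t ^ n * (t ^ m)⁻¹) * (w ^ k * (w ^ n * w ^ m))) * h_exp

theorem hasSum_ramanujanA_mul_ramanujanA (hq : ‖q‖ < 1) (hq0 : q ≠ 0) {w t : ℂ} (hw : w ≠ 0)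
    (ht : t ≠ 0) :
    HasSum (fun k : ℤ => w ^ k * q ^ tri k * ramanujanA q (w * t * q ^ k) *
        ramanujanA q (w * t⁻¹ * q ^ k))
      ((∑' p, productKernel q t p) * (qPochInf q q * theta q (-w))) := by
  rw [← jacobi_triple_product hq hq0 hw]
  refine hasSum_shear (fun p : ℕ × ℕ => (p.1 : ℤ) + p.2) (summable_norm_productKernel hq hq0 t)
    (summable_norm_zpow_mul_tri hq hq0 w) fun k => ?_
  have h_summable := summable_mul_of_summable_norm (summable_norm_ramanujanA hq (w * t * q ^ k))
    (summable_norm_ramanujanA hq (w * t⁻¹ * q ^ k))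
  have h_double := (hasSum_ramanujanA hq (w * t * q ^ k)).mul
    (hasSum_ramanujanA hq (w * t⁻¹ * q ^ k)) h_summable
  rw [mul_assoc (w ^ k * q ^ tri k)]
  exact (h_double.mul_left (w ^ k * q ^ tri k)).congr_fun fun p =>
    productKernel_mul_zpow_mul_tri hq0 hw ht p.1 p.2 k

theorem productKernel_inv_swap (hq0 : q ≠ 0) (t : ℂ) (p : ℕ × ℕ) :
    productKernel q t⁻¹ p.swap = productKernel q t p := by
  have h_exp : q ^ tri ((p.2 : ℤ) - p.1) * q ^ p.2 = q ^ tri ((p.1 : ℤ) - p.2) * q ^ p.1 := by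
    simp only [← zpow_natCast, ← zpow_add₀ hq0, tri_sub]
    congr 1
    ring
  simp only [productKernel, Prod.fst_swap, Prod.snd_swap]
  rw [inv_zpow', neg_sub]
  linear_combination ((-1) ^ p.2 * (-1) ^ p.1 * (qPoch q q p.2)⁻¹ * (qPoch q q p.1)⁻¹ *
    t ^ ((p.1 : ℤ) - p.2)) * h_exp

theorem tsum_productKernel_inv (hq0 : q ≠ 0) (t : ℂ) :
    ∑' p, productKernel q t⁻¹ p = ∑' p, productKernel q t p := by
  rw [← (Equiv.prodComm ℕ ℕ).tsum_eq]
  exact tsum_congr (productKernel_inv_swap hq0 t)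

theorem tsum_productKernel (hq : ‖q‖ < 1) (hq0 : q ≠ 0) {t : ℂ} (ht : t ≠ 0) :
    ∑' p, productKernel q t p = ∑' n : ℕ, (-1) ^ n * (qPoch q q n)⁻¹ * t ^ n *
      q ^ (tri n + n) * qPochInf (t⁻¹ * q ^ (1 - n : ℤ)) q := by
  refine ((summable_norm_productKernel hq hq0 t).of_norm.hasSum.prod_fiberwise
    fun n => ?_).tsum_eq.symm
  refine ((hasSum_qPochInf hq (t⁻¹ * q ^ (1 - n : ℤ))).mul_left
    ((-1) ^ n * (qPoch q q n)⁻¹ * t ^ n * q ^ (tri n + n))).congr_fun fun m => ?_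
  have h_exp : q ^ tri ((n : ℤ) - m) * q ^ n =
      q ^ (tri n + n) * q ^ m.choose 2 * (q ^ (1 - n : ℤ)) ^ m := by
    simp only [← zpow_natCast, ← zpow_mul, ← zpow_add₀ hq0, tri_sub, tri_natCast]
    congr 1
    ring
  simp only [productKernel, zpow_sub₀ ht, zpow_natCast, mul_pow, inv_pow, div_eq_mul_inv]
  linear_combination ((-1) ^ n * (-1) ^ m * (qPoch q q n)⁻¹ * (qPoch q q m)⁻¹ *
    (t ^ n * (t ^ m)⁻¹)) * h_exp

theorem tsum_productKernel_zpow_of_nonneg (hq : ‖q‖ < 1) (hq0 : q ≠ 0) {l : ℤ} (hl : 0 ≤ l) :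
    ∑' p, productKernel q (q ^ l) p = if l = 0 then qPochInf q q else 0 := by
  rw [tsum_productKernel hq hq0 (zpow_ne_zero l hq0)]
  simp only [← zpow_neg, ← zpow_add₀ hq0]
  rw [tsum_eq_single 0 fun n hn => by rw [qPochInf_zpow_of_nonpos hq0 (by lia), mul_zero]]
  split_ifs with hl0
  · subst hl0
    simp [qPoch_zero, tri]
  · rw [qPochInf_zpow_of_nonpos hq0 (by lia), mul_zero]

theorem tsum_productKernel_zpow (hq : ‖q‖ < 1) (hq0 : q ≠ 0) (l : ℤ) :
    ∑' p, productKernel q (q ^ l) p = if l = 0 then qPochInf q q else 0 := by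
  rcases le_total 0 l with hl | hl
  · exact tsum_productKernel_zpow_of_nonneg hq hq0 hl
  · rw [← tsum_productKernel_inv hq0, ← zpow_neg,
      tsum_productKernel_zpow_of_nonneg hq hq0 (neg_nonneg.mpr hl)]
    simp only [neg_eq_zero]

theorem hasSum_ramanujanA_mul_ramanujanA_zpow (hq : ‖q‖ < 1) (hq0 : q ≠ 0) {w t : ℂ} (hw : w ≠ 0)
    (ht : t ≠ 0) (l : ℤ) :
    HasSum (fun k : ℤ => w ^ k * q ^ tri k * ramanujanA q (w * t * q ^ (k + l)) *
        ramanujanA q (w * t⁻¹ * q ^ (k - l)))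
      ((∑' p, productKernel q (t * q ^ l) p) * (qPochInf q q * theta q (-w))) := by
  convert hasSum_ramanujanA_mul_ramanujanA hq hq0 hw (mul_ne_zero ht (zpow_ne_zero l hq0))
    using 4 with k
  · rw [zpow_add₀ hq0]
    ring_nf
  · rw [zpow_sub₀ hq0, mul_inv]
    ring_nf

theorem hasSum_ramanujanA_mul_ramanujanA_self (hq : ‖q‖ < 1) (hq0 : q ≠ 0) {z : ℂ} (hz : z ≠ 0)
    (l : ℤ) :
    HasSum (fun k : ℤ => z ^ k * q ^ tri k * ramanujanA q (z * q ^ (k + l)) *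
        ramanujanA q (z * q ^ (k - l)))
      (qPochInf q q ^ 2 * theta q (-z) * (if l = 0 then 1 else 0)) := by
  have h := hasSum_ramanujanA_mul_ramanujanA_zpow hq hq0 hz one_ne_zero l
  simp only [inv_one, mul_one, one_mul, tsum_productKernel_zpow hq hq0] at h
  convert h using 1
  split_ifs <;> ring

theorem hasSum_ramanujanA_mul_ramanujanA_inv (hq : ‖q‖ < 1) (hq0 : q ≠ 0) {z : ℂ} (hz : z ≠ 0)
    (l : ℤ) :
    HasSum (fun k : ℤ => (-1) ^ k * q ^ tri k * ramanujanA q (z * q ^ (k + l)) *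
        ramanujanA q (z⁻¹ * q ^ (k - l))) 0 := by
  have h := hasSum_ramanujanA_mul_ramanujanA_zpow hq hq0 (neg_ne_zero.mpr one_ne_zero)
    (neg_ne_zero.mpr hz) l
  simpa only [neg_neg, theta_one, mul_zero, inv_neg, neg_mul_neg, one_mul] using h

end Ramanujan

end QSeries

theorem mainTheorem10_general (q : ℂ) (hq0 : q ≠ 0) (hq1 : ‖q‖ < 1) (z : ℂ) (hz : z ≠ 0) (l : ℤ) :
    HasSum
      (fun k : ℤ => z ^ k * q ^ (k * (k - 1) / 2) *
        QSeries.ramanujanA q (z * q ^ (k + l)) *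
        QSeries.ramanujanA q (z * q ^ (k - l)))
      (QSeries.qPochInf q q ^ 2 * QSeries.theta q (-z) * (if l = 0 then 1 else 0)) ∧
    HasSum
      (fun k : ℤ => (-1 : ℂ) ^ k * q ^ (k * (k - 1) / 2) *
        QSeries.ramanujanA q (z * q ^ (k + l)) *
        QSeries.ramanujanA q (z⁻¹ * q ^ (k - l)))
      0 :=
  ⟨QSeries.hasSum_ramanujanA_mul_ramanujanA_self hq1 hq0 hz l,
    QSeries.hasSum_ramanujanA_mul_ramanujanA_inv hq1 hq0 hz l⟩

theorem mainTheorem10 (q : ℝ) (hq0 : 0 < q) (hq1 : q < 1) (z : ℂ) (hz : z ≠ 0) (l : ℤ) :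
    HasSum
      (fun k : ℤ => z ^ k * (q : ℂ) ^ (k * (k - 1) / 2) *
        QSeries.ramanujanA q (z * (q : ℂ) ^ (k + l)) *
        QSeries.ramanujanA q (z * (q : ℂ) ^ (k - l)))
      (QSeries.qPochInf q q ^ 2 * QSeries.theta q (-z) * (if l = 0 then 1 else 0)) ∧
    HasSum
      (fun k : ℤ => (-1 : ℂ) ^ k * (q : ℂ) ^ (k * (k - 1) / 2) *
        QSeries.ramanujanA q (z * (q : ℂ) ^ (k + l)) *
        QSeries.ramanujanA q (z⁻¹ * (q : ℂ) ^ (k - l)))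
      0 :=
  mainTheorem10_general q (Complex.ofReal_ne_zero.mpr hq0.ne')
    (by rwa [Complex.norm_real, Real.norm_of_nonneg hq0.le]) z hz l
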